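/- Let $X$ be an Archimedean vector lattice (Riesz space) over $\mathbb R$. A filter $\mathcal F$ on $X$ \emph{converges in order} to $x$ if there is a net $(u_\gamma)$ in $X$ decreasing to infimum $0$ such that for every $\gamma$ the set $\{y\in X : |y-x|\le u_\gamma\}$ belongs to $\mathcal F$; it \emph{uo-converges} (converges in unbounded order) to $x$ if for every $u\in X_+$ the image of $\mathcal F$ under $y\mapsto |y-x|\wedge u$ converges in order to $0$. (A net converges if and only if its tail filter does.) A convergence is \emph{Choquet} if a filter $\mathcal F$ converges to $x$ whenever every ultrafilter containing $\mathcal F$ converges to $x$, and \emph{topological} if it is the convergence of filters with respect to some topology on the set $X$. An \emph{atom} of $X$ is a vector $a>0$ such that the ideal generated by $a$ is the line $\mathbb R a$, and $X$ is \emph{discrete} if there is a set of pairwise disjoint atoms such that only the zero vector is disjoint from all of them. Then the following are equivalent: (i) $X$ is discrete; (ii) order convergence on $X$ is Choquet; (iii) unbounded order convergence on $X$ is Choquet; (iv) unbounded order convergence on $X$ is topological. -/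

import Mathlib

universe u

/-- A (filter) convergence structure on a set: it specifies which filters converge to which points.
`G ≤ F` in Mathlib means that `G` contains `F` as a family of sets, and `F ⊔ G` is the family of
the sets that belong to both. The improper filter `⊥` converges to every point by `pure_conv` and
`mono`, so that its presence is immaterial: such structures correspond exactly to convergence
structures on proper filters. A net converges when its tail filter
`Filter.map x Filter.atTop` does. -/
structure ConvergenceStructure (X : Type u) where
  conv : Filter X → X → Prop
  pure_conv : ∀ x, conv (pure x) x
  mono : ∀ {F G : Filter X} {x : X}, conv F x → G ≤ F → conv G x
  sup : ∀ {F G : Filter X} {x : X}, conv F x → conv G x → conv (F ⊔ G) x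

namespace ConvergenceStructure

/-- A filter converges to `x` as soon as all the ultrafilters containing it do. -/
def IsChoquet {X : Type u} (η : ConvergenceStructure X) : Prop :=
  ∀ (F : Filter X) (x : X), (∀ U : Ultrafilter X, (U : Filter X) ≤ F → η.conv U x) → η.conv F x

/-- The convergence is the convergence of some topology on the set. -/
def IsTopological {X : Type u} (η : ConvergenceStructure X) : Prop :=
  ∃ τ : TopologicalSpace X, ∀ (F : Filter X) (x : X), η.conv F x ↔ F ≤ @nhds X τ x

end ConvergenceStructure

section VectorLattice

variable (X : Type u) [AddCommGroup X] [Lattice X]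

/-- The net `(w γ)` is decreasing and has infimum `0`. -/
def DecreasesToZero {X : Type u} [AddCommGroup X] [Lattice X] {Γ : Type u} [Preorder Γ]
    (w : Γ → X) : Prop :=
  Antitone w ∧ IsGLB (Set.range w) 0

/-- Order convergence: there is a net `w γ ↓ 0` such that for every `γ` the inequality
`|y - x| ≤ w γ` holds eventually along the filter. For the tail filter of a net `(x α)` this says
that for every `γ` there is `α₀` with `|x α - x| ≤ w γ` for all `α ≥ α₀`. -/
def OrderConverges {X : Type u} [AddCommGroup X] [Lattice X] (F : Filter X) (x : X) : Prop :=
  ∃ (Γ : Type u) (_ : Preorder Γ) (_ : IsDirectedOrder Γ) (_ : Nonempty Γ) (w : Γ → X),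
    DecreasesToZero w ∧ ∀ γ, ∀ᶠ y in F, |y - x| ≤ w γ

/-- Order convergence as a convergence structure. -/
def orderConvergence [IsOrderedAddMonoid X] : ConvergenceStructure X where
  conv := OrderConverges
  pure_conv x := by
    refine ⟨PUnit, inferInstance, inferInstance, inferInstance, fun _ => 0,
      ⟨fun _ _ _ => le_rfl, ?_⟩, ?_⟩
    · simp
    · simp
  mono := by
    rintro F G x ⟨Γ, h1, h2, h3, w, hw, h⟩ hGF
    exact ⟨Γ, h1, h2, h3, w, hw, fun γ => hGF (h γ)⟩
  sup := by
    rintro F G x ⟨Γ, h1, h2, h3, w, ⟨hwa, hwg⟩, h⟩ ⟨Δ, k1, k2, k3, v, ⟨hva, hvg⟩, k⟩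
    have hw0 : ∀ γ, 0 ≤ w γ := fun γ => hwg.1 ⟨γ, rfl⟩
    have hv0 : ∀ δ, 0 ≤ v δ := fun δ => hvg.1 ⟨δ, rfl⟩
    have hdir : IsDirectedOrder (Γ × Δ) := by
      refine ⟨fun a b => ?_⟩
      obtain ⟨c, hc1, hc2⟩ := h2.directed a.1 b.1
      obtain ⟨d, hd1, hd2⟩ := k2.directed a.2 b.2
      exact ⟨(c, d), ⟨hc1, hd1⟩, ⟨hc2, hd2⟩⟩
    refine ⟨Γ × Δ, inferInstance, hdir, inferInstance, fun p => w p.1 + v p.2,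
      ⟨fun a b hab => add_le_add (hwa hab.1) (hva hab.2), ?_, ?_⟩, ?_⟩
    · rintro _ ⟨p, rfl⟩
      exact add_nonneg (hw0 p.1) (hv0 p.2)
    · intro z hz
      refine hvg.2 ?_
      rintro _ ⟨δ, rfl⟩
      refine sub_nonpos.1 (hwg.2 ?_)
      rintro _ ⟨γ, rfl⟩
      exact sub_le_iff_le_add.2 (hz ⟨(γ, δ), rfl⟩)
    · rintro ⟨γ, δ⟩
      refine Filter.eventually_sup.2 ⟨(h γ).mono fun y hy => ?_, (k δ).mono fun y hy => ?_⟩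
      · exact hy.trans (le_add_of_nonneg_right (hv0 δ))
      · exact hy.trans (le_add_of_nonneg_left (hw0 γ))

variable {X} in
/-- The unbounded modification of a convergence `η`: a net `(x α)` converges to `x` if
`|x α - x| ⊓ e` converges to `0` with respect to `η` for every `e ≥ 0`. -/
def ConvergenceStructure.unbounded [IsOrderedAddMonoid X] (η : ConvergenceStructure X) :
    ConvergenceStructure X where
  conv F x := ∀ e : X, 0 ≤ e → η.conv (Filter.map (fun y => |y - x| ⊓ e) F) 0
  pure_conv x e he := by
    simpa [Filter.map_pure, inf_eq_left.2 he] using η.pure_conv 0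
  mono h hGF e he := η.mono (h e he) (Filter.map_mono hGF)
  sup h k e he := by
    rw [Filter.map_sup]
    exact η.sup (h e he) (k e he)

/-- Unbounded order convergence (uo-convergence). -/
def uoConvergence [IsOrderedAddMonoid X] : ConvergenceStructure X :=
  (orderConvergence X).unbounded

/-- The Archimedean property of an ordered vector space. Mathlib's class `Archimedean` is a
different, much stronger property when the order is not total. -/
def IsArchimedeanLattice : Prop :=
  ∀ x y : X, (∀ n : ℕ, n • x ≤ y) → x ≤ 0

variable {X} in
/-- `a > 0` is an atom (a discrete element) of a vector lattice: the ideal generated by `a` is the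
line spanned by `a`. -/
def IsLatticeAtom [Module ℝ X] (a : X) : Prop :=
  0 < a ∧ ∀ x : X, (∃ r : ℝ, |x| ≤ r • a) → ∃ c : ℝ, x = c • a

/-- A vector lattice is discrete if it has a complete disjoint system of atoms: pairwise disjoint
atoms such that only the zero vector is disjoint from all of them. -/
def IsDiscreteLattice [Module ℝ X] : Prop :=
  ∃ S : Set X, (∀ a ∈ S, IsLatticeAtom a) ∧ (∀ a ∈ S, ∀ b ∈ S, a ≠ b → a ⊓ b = 0) ∧
    ∀ x : X, (∀ a ∈ S, |x| ⊓ a = 0) → x = 0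

end VectorLattice

set_option linter.unusedSectionVars false

/-! ### Disjointness and Archimedean estimates -/

section LatticeGroup

open Filter Topology

variable {X : Type u} [AddCommGroup X] [Lattice X] [IsOrderedAddMonoid X]

/-! If `X` is discrete, each atom `a` gives a pseudometric, the coefficient of `|x - y| ⊓ a` along
`a`. Uo-convergence is convergence for all of these, hence topological (`uoConverges_of_forall_atom`
is the hard half), hence Choquet. Truncation preserves the Choquet property because ultrafilters
lift along maps. Conversely, order convergence is uo-convergence plus order boundedness, and
ultrafilters detect boundedness.

If `X` is not discrete, some `e > 0` has no atom below it. The filter `smallSupportFilter e` does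
not uo-converge to `0`, since its nonnegative eventual upper bounds all dominate `e`. But each finer
ultrafilter does: given a lower bound `z > 0` of its eventual bounds, split off disjoint `b, c` in
`(0, z]`. The ultrafilter is eventually disjoint from one of them, which contradicts the Archimedean
property. -/

theorem add_inf_le_inf_add_inf {a b c : X} (ha : 0 ≤ a) (hb : 0 ≤ b) (hc : 0 ≤ c) :
    (a + b) ⊓ c ≤ a ⊓ c + b ⊓ c := by
  rw [add_inf, inf_add, inf_add]
  refine le_inf (le_inf inf_le_left ?_) (le_inf ?_ ?_)
  · exact inf_le_right.trans (le_add_of_nonneg_right hb)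
  · exact inf_le_right.trans (le_add_of_nonneg_left ha)
  · exact inf_le_right.trans (le_add_of_nonneg_left hc)

theorem nsmul_inf_eq_zero {b c : X} (hb : 0 ≤ b) (hc : 0 ≤ c) (h : b ⊓ c = 0) (n : ℕ) :
    (n • b) ⊓ c = 0 := by
  induction n with
  | zero => simpa using hc
  | succ n ih =>
    refine le_antisymm ?_ (le_inf (nsmul_nonneg hb _) hc)
    rw [succ_nsmul]
    refine (add_inf_le_inf_add_inf (nsmul_nonneg hb n) hb hc).trans ?_
    rw [ih, h, add_zero]

theorem inf_eq_zero_of_le {b c y z : X} (hy : 0 ≤ y) (hz : 0 ≤ z) (hyb : y ≤ b) (hzc : z ≤ c)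
    (h : b ⊓ c = 0) : y ⊓ z = 0 :=
  le_antisymm ((inf_le_inf hyb hzc).trans h.le) (le_inf hy hz)

theorem add_le_of_inf_eq_zero {a b c : X} (h : a ⊓ b = 0) (ha : a ≤ c) (hb : b ≤ c) :
    a + b ≤ c := by
  rw [← inf_add_sup, h, zero_add]
  exact sup_le ha hb

/-- Inductively `n • b ≤ e`: then `e ⊓ n • b` is `n • b`, and the hypothesis gives the next
multiple. -/
theorem nonpos_of_add_inf_nsmul_le (hX : IsArchimedeanLattice X) {b e : X} (he : 0 ≤ e)
    (h : ∀ n : ℕ, b + e ⊓ (n • b) ≤ e) : b ≤ 0 := by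
  refine hX b e fun n => ?_
  induction n with
  | zero => simpa using he
  | succ n ih =>
    have := h n
    rwa [inf_eq_right.2 ih, add_comm, ← succ_nsmul] at this

/-! ### Order and uo-convergence, and the Choquet property -/

/-- Order convergence is witnessed by the set of all eventual bounds. -/
theorem orderConverges_of_forall_lower {F : Filter X} {x : X} (hne : ∃ w, ∀ᶠ y in F, |y - x| ≤ w)
    (h : F.NeBot → ∀ z, 0 ≤ z → (∀ w, (∀ᶠ y in F, |y - x| ≤ w) → z ≤ w) → z = 0) :
    OrderConverges F x := by
  rcases F.eq_or_neBot with rfl | hF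
  · exact (orderConvergence X).mono ((orderConvergence X).pure_conv x) bot_le
  have h0 : ∀ w, (∀ᶠ y in F, |y - x| ≤ w) → 0 ≤ w := fun w hw => by
    obtain ⟨y, hy⟩ := hw.exists
    exact (abs_nonneg _).trans hy
  refine ⟨{w : X // ∀ᶠ y in F, |y - x| ≤ w}ᵒᵈ, inferInstance, ⟨fun v w => ?_⟩, ?_,
    fun w => (OrderDual.ofDual w).1, ⟨fun v w hvw => hvw, ?_, ?_⟩,
    fun w => (OrderDual.ofDual w).2⟩
  · refine ⟨OrderDual.toDual ⟨(OrderDual.ofDual v).1 ⊓ (OrderDual.ofDual w).1, ?_⟩, ?_, ?_⟩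
    · filter_upwards [(OrderDual.ofDual v).2, (OrderDual.ofDual w).2] with y h1 h2
      exact le_inf h1 h2
    · exact inf_le_left (a := (OrderDual.ofDual v).1)
    · exact inf_le_right (a := (OrderDual.ofDual v).1)
  · obtain ⟨w, hw⟩ := hne
    exact ⟨OrderDual.toDual ⟨w, hw⟩⟩
  · rintro _ ⟨w, rfl⟩
    exact h0 _ (OrderDual.ofDual w).2
  · intro z hz
    have : z ⊔ 0 = 0 := h hF (z ⊔ 0) le_sup_right fun w hw =>
      sup_le (hz ⟨OrderDual.toDual ⟨w, hw⟩, rfl⟩) (h0 w hw)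
    exact le_sup_left.trans this.le

theorem abs_abs_inf_sub_zero {q e : X} (he : 0 ≤ e) : |(|q| ⊓ e) - 0| = |q| ⊓ e := by
  rw [sub_zero, abs_of_nonneg (le_inf (abs_nonneg q) he)]

theorem uoConverges_iff {F : Filter X} {x : X} :
    (uoConvergence X).conv F x ↔
      ∀ e, 0 ≤ e → OrderConverges (map (fun y => |y - x| ⊓ e) F) 0 := Iff.rfl

theorem OrderConverges.uoConverges {F : Filter X} {x : X} (h : OrderConverges F x) :
    (uoConvergence X).conv F x := by
  obtain ⟨Γ, _, h2, h3, w, hw, h⟩ := h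
  refine fun e he => ⟨Γ, _, h2, h3, w, hw, fun γ => ?_⟩
  rw [eventually_map]
  filter_upwards [h γ] with y hy
  rw [abs_abs_inf_sub_zero he]
  exact inf_le_left.trans hy

theorem orderConverges_of_uoConverges {F : Filter X} {x e : X}
    (h : (uoConvergence X).conv F x) (hb : ∀ᶠ y in F, |y - x| ≤ e) : OrderConverges F x := by
  -- Truncating at a bound changes nothing; `|e|` is used because `e` need not be nonnegative when
  -- `F = ⊥`.
  obtain ⟨Γ, _, h2, h3, w, hw, h⟩ := h |e| (abs_nonneg e)
  refine ⟨Γ, _, h2, h3, w, hw, fun γ => ?_⟩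
  filter_upwards [eventually_map.1 (h γ), hb] with y hy hye
  rwa [abs_abs_inf_sub_zero (abs_nonneg e), inf_eq_left.2 (hye.trans (le_abs_self e))] at hy

theorem OrderConverges.exists_bound {F : Filter X} {x : X} (h : OrderConverges F x) :
    ∃ w, ∀ᶠ y in F, |y - x| ≤ w := by
  obtain ⟨Γ, _, _, ⟨γ⟩, w, _, h⟩ := h
  exact ⟨w γ, h γ⟩

/-- A filter is order bounded as soon as all the ultrafilters containing it are. -/
theorem exists_bound_of_forall_ultrafilter {F : Filter X} {x : X}
    (h : ∀ U : Ultrafilter X, (U : Filter X) ≤ F → ∃ w, ∀ᶠ y in (U : Filter X), |y - x| ≤ w) :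
    ∃ w, ∀ᶠ y in F, |y - x| ≤ w := by
  by_contra! hF
  -- If `F` is unbounded, it is compatible with the complements of all order balls around `x`; an
  -- ultrafilter finer than both has no bound.
  let G : Filter X := ⨅ w : X, 𝓟 {y | ¬ |y - x| ≤ w}
  have hdir : Directed (· ≥ ·) fun w : X => 𝓟 {y : X | ¬ |y - x| ≤ w} := fun v w =>
    ⟨v ⊔ w, principal_mono.2 fun y hy h => hy (h.trans le_sup_left),
      principal_mono.2 fun y hy h => hy (h.trans le_sup_right)⟩
  have hne : (F ⊓ G).NeBot := by
    rw [inf_iInf, iInf_neBot_iff_of_directed]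
    · intro w
      rw [← frequently_mem_iff_neBot]
      exact hF w
    · intro v w
      obtain ⟨u, hu1, hu2⟩ := hdir v w
      exact ⟨u, inf_le_inf_left _ hu1, inf_le_inf_left _ hu2⟩
  obtain ⟨U, hU⟩ := Ultrafilter.exists_le (F ⊓ G)
  obtain ⟨w, hw⟩ := h U (hU.trans inf_le_left)
  have hw' : ∀ᶠ y in (U : Filter X), ¬ |y - x| ≤ w :=
    (hU.trans (inf_le_right.trans (iInf_le _ w))) (mem_principal_self _)
  obtain ⟨y, h1, h2⟩ := (hw.and hw').exists
  exact h2 h1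

theorem exists_ultrafilter_map_eq {α β : Type*} {m : α → β} {F : Filter α} {V : Ultrafilter β}
    (h : (V : Filter β) ≤ map m F) :
    ∃ U : Ultrafilter α, (U : Filter α) ≤ F ∧ U.map m = V := by
  have hne : (F ⊓ comap m V).NeBot := by
    rw [← map_neBot_iff m, Filter.push_pull, inf_eq_right.2 h]
    infer_instance
  obtain ⟨U, hU⟩ := Ultrafilter.exists_le (F ⊓ comap m V)
  refine ⟨U, hU.trans inf_le_left, Ultrafilter.coe_le_coe.1 ?_⟩
  exact map_le_iff_le_comap.2 (hU.trans inf_le_right)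

theorem ConvergenceStructure.IsChoquet.unbounded {η : ConvergenceStructure X}
    (h : η.IsChoquet) : η.unbounded.IsChoquet := by
  refine fun F x hF e he => h _ _ fun V hV => ?_
  obtain ⟨U, hU, rfl⟩ := exists_ultrafilter_map_eq hV
  exact hF U hU e he

theorem ConvergenceStructure.IsTopological.isChoquet {η : ConvergenceStructure X}
    (h : η.IsTopological) : η.IsChoquet := by
  obtain ⟨τ, h⟩ := h
  exact fun F x hF => (h F x).2 (le_iff_ultrafilter.2 fun U hU => (h _ _).1 (hF U hU))

theorem orderConvergence_isChoquet_of_uoConvergence (h : (uoConvergence X).IsChoquet) :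
    (orderConvergence X).IsChoquet := by
  intro F x hF
  obtain ⟨w, hw⟩ := exists_bound_of_forall_ultrafilter fun U hU =>
    OrderConverges.exists_bound (hF U hU)
  exact orderConverges_of_uoConverges (h F x fun U hU => OrderConverges.uoConverges (hF U hU)) hw

/-! ### The filter of elements of small support -/

/-- The filter of the sets `T` such that below each element of `(0, e]` there is some `x' > 0`
for which `T` contains all the elements of `[0, e]` dominated by a multiple of `x'`. -/
def smallSupportFilter (e : X) : Filter X where
  sets := {T | ∀ x, 0 < x → x ≤ e → ∃ x', 0 < x' ∧ x' ≤ x ∧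
    ∀ y, 0 ≤ y → y ≤ e → (∃ n : ℕ, y ≤ n • x') → y ∈ T}
  univ_sets x hx _ := ⟨x, hx, le_rfl, fun _ _ _ _ => trivial⟩
  sets_of_superset h hST x hx hxe := by
    obtain ⟨x', h0, hx', h⟩ := h x hx hxe
    exact ⟨x', h0, hx', fun y h1 h2 h3 => hST (h y h1 h2 h3)⟩
  inter_sets h k x hx hxe := by
    obtain ⟨x', h0, hx', h⟩ := h x hx hxe
    obtain ⟨x'', k0, hx'', k⟩ := k x' h0 (hx'.trans hxe)
    refine ⟨x'', k0, hx''.trans hx', fun y h1 h2 h3 => ⟨h y h1 h2 ?_, k y h1 h2 h3⟩⟩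
    obtain ⟨n, hn⟩ := h3
    exact ⟨n, hn.trans (nsmul_le_nsmul_right hx'' n)⟩

theorem eventually_smallSupportFilter_mem_Icc (e : X) :
    ∀ᶠ y in smallSupportFilter e, 0 ≤ y ∧ y ≤ e :=
  fun x hx _ => ⟨x, hx, le_rfl, fun _ h1 h2 _ => ⟨h1, h2⟩⟩

/-- Below a given `x`, take `x` itself if it is disjoint from `b`, and otherwise `x ⊓ b`, which is
disjoint from `c`. -/
theorem eventually_smallSupportFilter_disjoint (e : X) {b c : X} (hb : 0 ≤ b) (hc : 0 ≤ c)
    (h : b ⊓ c = 0) : ∀ᶠ y in smallSupportFilter e, y ⊓ b = 0 ∨ y ⊓ c = 0 := by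
  intro x hx hxe
  by_cases hxb : x ⊓ b = 0
  · refine ⟨x, hx, le_rfl, fun y h1 _ ⟨n, hn⟩ => Or.inl ?_⟩
    exact inf_eq_zero_of_le h1 hb hn le_rfl (nsmul_inf_eq_zero hx.le hb hxb n)
  · have h0 : 0 ≤ x ⊓ b := le_inf hx.le hb
    refine ⟨x ⊓ b, h0.lt_of_ne (Ne.symm hxb), inf_le_left, fun y h1 _ ⟨n, hn⟩ => Or.inr ?_⟩
    refine inf_eq_zero_of_le h1 hc hn le_rfl (nsmul_inf_eq_zero h0 hc ?_ n)
    exact inf_eq_zero_of_le h0 hc inf_le_right le_rfl h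

/-- Otherwise `e - e ⊓ w > 0` has some `x' > 0` below it with every `e ⊓ n • x'` below `w`. Then `x'
+ e ⊓ n • x' ≤ e` for all `n`, which the Archimedean property forbids. -/
theorem le_of_eventually_smallSupportFilter_le (hX : IsArchimedeanLattice X) {e w : X}
    (he : 0 ≤ e) (hw0 : 0 ≤ w) (hw : ∀ᶠ y in smallSupportFilter e, y ≤ w) : e ≤ w := by
  by_contra hew
  have hx0 : 0 < e - e ⊓ w := by
    refine (sub_nonneg.2 inf_le_left).lt_of_ne fun h => hew ?_
    exact inf_eq_left.1 (sub_eq_zero.1 h.symm).symm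
  obtain ⟨x', h0, hx', h⟩ := hw _ hx0 (sub_le_self _ (le_inf he hw0))
  refine h0.not_ge (nonpos_of_add_inf_nsmul_le hX he fun n => ?_)
  have h1 : e ⊓ (n • x') ≤ w :=
    h _ (le_inf he (nsmul_nonneg h0.le n)) inf_le_left ⟨n, inf_le_right⟩
  exact (add_le_add hx' (le_inf inf_le_left h1)).trans (sub_add_cancel _ _).le

theorem not_uoConverges_smallSupportFilter (hX : IsArchimedeanLattice X) {e : X} (he : 0 < e) :
    ¬ (uoConvergence X).conv (smallSupportFilter e) 0 := by
  intro h
  obtain ⟨Γ, _, _, _, w, ⟨_, hw⟩, h⟩ := h e he.le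
  refine he.not_ge (hw.2 ?_)
  rintro _ ⟨γ, rfl⟩
  refine le_of_eventually_smallSupportFilter_le hX he.le (hw.1 ⟨γ, rfl⟩) ?_
  filter_upwards [eventually_map.1 (h γ), eventually_smallSupportFilter_mem_Icc e] with y hy hye
  rwa [abs_abs_inf_sub_zero he.le, sub_zero, abs_of_nonneg hye.1, inf_eq_left.2 hye.2] at hy

/-- If no element of `(0, e]` is an atom, the ultrafilters containing `smallSupportFilter e`
converge to `0`. -/
theorem uoConverges_of_le_smallSupportFilter (hX : IsArchimedeanLattice X) {e : X}
    (hsplit : ∀ z, 0 < z → z ≤ e → ∃ b c, 0 < b ∧ 0 < c ∧ b ≤ z ∧ c ≤ z ∧ b ⊓ c = 0)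
    {U : Ultrafilter X} (hU : (U : Filter X) ≤ smallSupportFilter e) :
    (uoConvergence X).conv U 0 := by
  have hIcc : ∀ᶠ y in (U : Filter X), 0 ≤ y ∧ y ≤ e :=
    hU (eventually_smallSupportFilter_mem_Icc e)
  suffices h : OrderConverges (U : Filter X) 0 from h.uoConverges
  have key : ∀ w, (∀ᶠ y in (U : Filter X), y ≤ w) → ∀ᶠ y in (U : Filter X), |y - 0| ≤ w := by
    intro w hw
    filter_upwards [hw, hIcc] with y hy hye
    rwa [sub_zero, abs_of_nonneg hye.1]
  have hUe : ∀ᶠ y in (U : Filter X), y ≤ e := hIcc.mono fun y hy => hy.2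
  refine orderConverges_of_forall_lower ⟨e, key e hUe⟩ fun _ z hz hzw => ?_
  by_contra hz0
  have he : 0 ≤ e := hz.trans (hzw e (key e hUe))
  obtain ⟨b, c, hb, hc, hbz, hcz, hbc⟩ :=
    hsplit z (hz.lt_of_ne (Ne.symm hz0)) (hzw e (key e hUe))
  -- If `y` is eventually disjoint from `d`, then `e - e ⊓ n • d` is an eventual bound, hence above
  -- `z ≥ d`, for every `n`.
  have aux : ∀ d, 0 < d → d ≤ z → ¬ ∀ᶠ y in (U : Filter X), y ⊓ d = 0 := by
    intro d hd hdz hy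
    refine hd.not_ge (nonpos_of_add_inf_nsmul_le hX he fun n => ?_)
    refine (add_le_add_left hdz _).trans (le_sub_iff_add_le.1 (hzw _ (key _ ?_)))
    filter_upwards [hy, hIcc] with y hyd hye
    refine le_sub_iff_add_le.2 (add_le_of_inf_eq_zero ?_ hye.2 inf_le_left)
    rw [inf_comm] at hyd ⊢
    exact inf_eq_zero_of_le (le_inf he (nsmul_nonneg hd.le n)) hye.1 inf_le_right le_rfl
      (nsmul_inf_eq_zero hd.le hye.1 hyd n)
  rcases Ultrafilter.eventually_or.1
    (hU (eventually_smallSupportFilter_disjoint e hb.le hc.le hbc)) with h | h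
  · exact aux b hb hbz h
  · exact aux c hc hcz h

end LatticeGroup

section VectorLattice

open Filter Topology

variable {X : Type u} [AddCommGroup X] [Lattice X] [IsOrderedAddMonoid X]
  [Module ℝ X] [IsOrderedModule ℝ X]

/-! ### Atoms and their coordinates -/

theorem le_of_smul_le_smul_of_pos {a : X} (ha : 0 < a) {s t : ℝ} (h : s • a ≤ t • a) :
    s ≤ t := by
  by_contra! hst
  refine ha.not_ge ?_
  have h1 : (s - t) • a ≤ 0 := by rwa [sub_smul, sub_nonpos]
  have h2 := smul_le_smul_of_nonneg_left h1 (inv_nonneg.2 (sub_pos.2 hst).le)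
  rwa [smul_zero, smul_smul, inv_mul_cancel₀ (sub_pos.2 hst).ne', one_smul] at h2

theorem exists_nsmul_smul_not_le (hX : IsArchimedeanLattice X) {a e : X} (ha : 0 < a) {ε : ℝ}
    (hε : 0 < ε) : ∃ n : ℕ, ¬ ((n : ℝ) * ε) • a ≤ e := by
  by_contra! h
  have h1 : ε • a ≤ 0 := hX _ e fun n => by
    have := h n
    rwa [mul_smul, Nat.cast_smul_eq_nsmul] at this
  exact hε.not_ge (le_of_smul_le_smul_of_pos ha (by rwa [zero_smul]))

/-- Without such a pair, one of the two disjoint parts of `x - t • z` vanishes for every `x` in the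
ideal of `z`. So `x` is comparable with every multiple of `z` and defines a cut in `ℝ`; by the
Archimedean property `x` is the multiple at the cut. -/
theorem exists_disjoint_le_of_not_isLatticeAtom (hX : IsArchimedeanLattice X) {z : X} (hz : 0 < z)
    (hna : ¬ IsLatticeAtom z) : ∃ b c, 0 < b ∧ 0 < c ∧ b ≤ z ∧ c ≤ z ∧ b ⊓ c = 0 := by
  by_contra! hcon
  refine hna ⟨hz, fun x ⟨r, hr⟩ => ?_⟩
  have hdom : ∀ p : X, 0 ≤ p → (∃ n : ℕ, p ≤ n • z) → p ⊓ z = 0 → p = 0 := fun p hp ⟨n, hn⟩ h => by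
    have := nsmul_inf_eq_zero hz.le hp (by rwa [inf_comm]) n
    rwa [inf_eq_right.2 hn] at this
  have hdisj : ∀ p q : X, 0 ≤ p → 0 ≤ q → (∃ n : ℕ, p ≤ n • z) → (∃ n : ℕ, q ≤ n • z) →
      p ⊓ q = 0 → p = 0 ∨ q = 0 := by
    intro p q hp hq hpn hqn h
    by_contra! hne
    have hp' : 0 < p ⊓ z :=
      (le_inf hp hz.le).lt_of_ne fun h => hne.1 (hdom p hp hpn h.symm)
    have hq' : 0 < q ⊓ z :=
      (le_inf hq hz.le).lt_of_ne fun h => hne.2 (hdom q hq hqn h.symm)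
    exact hcon _ _ hp' hq' inf_le_right inf_le_right
      (inf_eq_zero_of_le hp'.le hq'.le inf_le_left inf_le_left h)
  have hcomp : ∀ t : ℝ, t • z ≤ x ∨ x ≤ t • z := by
    intro t
    have hbd : ∃ n : ℕ, |x - t • z| ≤ n • z := by
      obtain ⟨n, hn⟩ := exists_nat_ge (r + |t|)
      refine ⟨n, ?_⟩
      have h1 : |t • z| ≤ |t| • z := by
        refine abs_le'.2 ⟨smul_le_smul_of_nonneg_right (le_abs_self t) hz.le, ?_⟩
        rw [← neg_smul]
        exact smul_le_smul_of_nonneg_right (neg_le_abs t) hz.le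
      calc |x - t • z| ≤ |x| + |t • z| := by
            rw [sub_eq_add_neg, ← abs_neg (t • z)]
            exact abs_add_le _ _
        _ ≤ r • z + |t| • z := add_le_add hr h1
        _ = (r + |t|) • z := (add_smul _ _ _).symm
        _ ≤ (n : ℝ) • z := smul_le_smul_of_nonneg_right hn hz.le
        _ = n • z := Nat.cast_smul_eq_nsmul ℝ n z
    obtain ⟨n, hn⟩ := hbd
    rcases hdisj _ _ (posPart_nonneg (x - t • z)) (negPart_nonneg (x - t • z))
      ⟨n, (sup_le (le_abs_self _) (abs_nonneg _)).trans hn⟩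
      ⟨n, (sup_le (neg_le_abs _) (abs_nonneg _)).trans hn⟩
      (posPart_inf_negPart_eq_zero _) with h | h
    · exact Or.inr (sub_nonpos.1 (posPart_eq_zero.1 h))
    · exact Or.inl (sub_nonneg.1 (negPart_eq_zero.1 h))
  have hbdd : BddAbove {t : ℝ | t • z ≤ x} :=
    ⟨r, fun t ht => le_of_smul_le_smul_of_pos hz (ht.trans ((le_abs_self x).trans hr))⟩
  have hne : {t : ℝ | t • z ≤ x}.Nonempty :=
    ⟨-r, by
      rw [Set.mem_ofPred_eq, neg_smul]
      exact neg_le.1 ((neg_le_abs x).trans hr)⟩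
  set T := sSup {t : ℝ | t • z ≤ x}
  have hlow : ∀ ε : ℝ, 0 < ε → (T - ε) • z ≤ x := fun ε hε => by
    obtain ⟨t, ht, hlt⟩ := exists_lt_of_lt_csSup hne (sub_lt_self T hε)
    exact (smul_le_smul_of_nonneg_right hlt.le hz.le).trans ht
  have hupp : ∀ ε : ℝ, 0 < ε → x ≤ (T + ε) • z := fun ε hε =>
    (hcomp (T + ε)).resolve_left fun h => (lt_add_of_pos_right T hε).not_ge (le_csSup hbdd h)
  have harch : ∀ y : X, (∀ ε : ℝ, 0 < ε → y ≤ ε • z) → y ≤ 0 := by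
    refine fun y hy => hX y z fun n => ?_
    have h1 := smul_le_smul_of_nonneg_left (hy (1 / ((n : ℝ) + 1)) (by positivity))
      (Nat.cast_nonneg (α := ℝ) n)
    rw [smul_smul, Nat.cast_smul_eq_nsmul] at h1
    refine h1.trans ((smul_le_smul_of_nonneg_right ?_ hz.le).trans (one_smul ℝ z).le)
    rw [mul_one_div, div_le_one (by positivity)]
    linarith
  refine ⟨T, le_antisymm (sub_nonpos.1 (harch _ fun ε hε => ?_))
    (sub_nonpos.1 (harch _ fun ε hε => ?_))⟩
  · rw [sub_le_iff_le_add, ← add_smul, add_comm]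
    exact hupp ε hε
  · rw [sub_le_comm, ← sub_smul]
    exact hlow ε hε

theorem IsLatticeAtom.exists_abs_inf_eq {a : X} (ha : IsLatticeAtom a) (x : X) :
    ∃ c : ℝ, |x| ⊓ a = c • a :=
  ha.2 _ ⟨1, by
    rw [one_smul, abs_of_nonneg (le_inf (abs_nonneg x) ha.1.le)]
    exact inf_le_right⟩

/-- The coordinate of `|x| ⊓ a` with respect to the atom `a`. -/
noncomputable def IsLatticeAtom.coord {a : X} (ha : IsLatticeAtom a) (x : X) : ℝ :=
  (ha.exists_abs_inf_eq x).choose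

theorem IsLatticeAtom.coord_smul {a : X} (ha : IsLatticeAtom a) (x : X) :
    ha.coord x • a = |x| ⊓ a :=
  (ha.exists_abs_inf_eq x).choose_spec.symm

theorem IsLatticeAtom.coord_le_iff {a : X} (ha : IsLatticeAtom a) {x : X} {ε : ℝ} :
    ha.coord x ≤ ε ↔ |x| ⊓ a ≤ ε • a := by
  rw [← ha.coord_smul]
  exact ⟨fun h => smul_le_smul_of_nonneg_right h ha.1.le, le_of_smul_le_smul_of_pos ha.1⟩

theorem IsLatticeAtom.coord_nonneg {a : X} (ha : IsLatticeAtom a) (x : X) : 0 ≤ ha.coord x := by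
  refine le_of_smul_le_smul_of_pos ha.1 ?_
  rw [zero_smul, ha.coord_smul]
  exact le_inf (abs_nonneg x) ha.1.le

/-- The pseudometric given by the coordinate with respect to an atom. -/
@[reducible]
noncomputable def IsLatticeAtom.pseudoMetricSpace {a : X} (ha : IsLatticeAtom a) :
    PseudoMetricSpace X where
  dist x y := ha.coord (x - y)
  dist_self x := by
    refine le_antisymm (ha.coord_le_iff.2 ?_) (ha.coord_nonneg _)
    rw [sub_self, abs_zero, zero_smul]
    exact inf_le_left
  dist_comm x y := by
    simp only [IsLatticeAtom.coord, abs_sub_comm x y]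
  dist_triangle x y z := by
    refine ha.coord_le_iff.2 ?_
    rw [add_smul, ha.coord_smul, ha.coord_smul, ← sub_add_sub_cancel x y z]
    exact (inf_le_inf_right _ (abs_add_le _ _)).trans
      (add_inf_le_inf_add_inf (abs_nonneg _) (abs_nonneg _) ha.1.le)

theorem IsLatticeAtom.le_nhds_iff {a : X} (ha : IsLatticeAtom a) {F : Filter X} {x : X} :
    F ≤ @nhds X ha.pseudoMetricSpace.toUniformSpace.toTopologicalSpace x ↔
      ∀ ε : ℝ, 0 < ε → ∀ᶠ y in F, |y - x| ⊓ a ≤ ε • a := by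
  let := ha.pseudoMetricSpace
  rw [(Metric.nhds_basis_closedBall (x := x)).ge_iff]
  refine forall₂_congr fun ε hε => ?_
  simp only [← ha.coord_le_iff]
  rfl

/-- Writing `q ⊓ T • a = s • a`, the hypothesis bounds only `min s 1` by `ε`; since `ε < 1`, this
bounds `s` itself. -/
theorem IsLatticeAtom.inf_smul_le {a q : X} (ha : IsLatticeAtom a) (hq : 0 ≤ q) {ε T : ℝ}
    (hε : ε < 1) (hT : 0 ≤ T) (h : q ⊓ a ≤ ε • a) : q ⊓ (T • a) ≤ ε • a := by
  obtain ⟨s, hs⟩ := ha.2 (q ⊓ (T • a)) ⟨T, by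
    rw [abs_of_nonneg (le_inf hq (smul_nonneg hT ha.1.le))]
    exact inf_le_right⟩
  rw [hs]
  refine smul_le_smul_of_nonneg_right ?_ ha.1.le
  have h1 : (min s 1) • a ≤ ε • a := by
    refine (le_inf ?_ ?_).trans h
    · exact (smul_le_smul_of_nonneg_right (min_le_left s 1) ha.1.le).trans
        (hs.ge.trans inf_le_left)
    · exact (smul_le_smul_of_nonneg_right (min_le_right s 1) ha.1.le).trans (one_smul ℝ a).le
  rcases min_le_iff.1 (le_of_smul_le_smul_of_pos ha.1 h1) with h2 | h2
  · exact h2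
  · exact absurd h2 hε.not_ge

/-- As the infimum is `0`, some `w γ` is not above `ε • a`; a coordinate exceeding `ε` would put `ε
• a` below it. -/
theorem IsLatticeAtom.eventually_of_uoConverges {a x : X} (ha : IsLatticeAtom a) {F : Filter X}
    (h : (uoConvergence X).conv F x) {ε : ℝ} (hε : 0 < ε) :
    ∀ᶠ y in F, |y - x| ⊓ a ≤ ε • a := by
  obtain ⟨Γ, _, _, _, w, ⟨_, hw⟩, h⟩ := h a ha.1.le
  have hγ : ∃ γ, ¬ ε • a ≤ w γ := by
    by_contra! hcon
    refine hε.not_ge (le_of_smul_le_smul_of_pos ha.1 ?_)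
    rw [zero_smul]
    refine hw.2 ?_
    rintro _ ⟨γ, rfl⟩
    exact hcon γ
  obtain ⟨γ, hγ⟩ := hγ
  filter_upwards [eventually_map.1 (h γ)] with y hy
  rw [abs_abs_inf_sub_zero ha.1.le, ← ha.coord_smul] at hy
  refine ha.coord_le_iff.1 ?_
  by_contra! hlt
  exact hγ ((smul_le_smul_of_nonneg_right hlt.le ha.1.le).trans hy)

/-- Suppose a lower bound `z ≥ 0` of the eventual bounds has coordinate `c > 0` at `a`. Split `e` as
`(e - T • a) + T • a` with `T • a` nearly maximal below `e`. The second summand contributes at most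
`ε • a` to `|y - x| ⊓ e`, so `z ≤ (e - T • a) + ε • a`; with `2ε ≤ c` this puts `(T + ε) • a` below
`e`. -/
theorem uoConverges_of_forall_atom (hX : IsArchimedeanLattice X) {S : Set X}
    (hS : ∀ a ∈ S, IsLatticeAtom a) (hcompl : ∀ x : X, (∀ a ∈ S, |x| ⊓ a = 0) → x = 0)
    {F : Filter X} {x : X}
    (h : ∀ a ∈ S, ∀ ε : ℝ, 0 < ε → ∀ᶠ y in F, |y - x| ⊓ a ≤ ε • a) :
    (uoConvergence X).conv F x := by
  rw [uoConverges_iff]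
  intro e he
  have key : ∀ w, (∀ᶠ y in F, |y - x| ⊓ e ≤ w) →
      ∀ᶠ y in map (fun y => |y - x| ⊓ e) F, |y - 0| ≤ w := by
    intro w hw
    rw [eventually_map]
    filter_upwards [hw] with y hy
    rwa [abs_abs_inf_sub_zero he]
  refine orderConverges_of_forall_lower
    ⟨e, key e (Eventually.of_forall fun y => inf_le_right)⟩ fun _ z hz hzw => ?_
  refine hcompl z fun a haS => ?_
  have ha := hS a haS
  rw [← ha.coord_smul]
  by_contra hne
  have hc : 0 < ha.coord z := (ha.coord_nonneg z).lt_of_ne fun h => hne (by rw [← h, zero_smul])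
  have hcz : ha.coord z • a ≤ z := by
    rw [ha.coord_smul, abs_of_nonneg hz]
    exact inf_le_left
  set c := ha.coord z
  obtain ⟨ε, hε, hεc, hε1⟩ : ∃ ε : ℝ, 0 < ε ∧ ε + ε ≤ c ∧ ε < 1 :=
    ⟨min (c / 2) (1 / 2), by positivity, by linarith [min_le_left (c / 2) (1 / 2)],
      by linarith [min_le_right (c / 2) (1 / 2)]⟩
  -- `T` is the multiple of `ε` just before the first one whose product with `a` is not below `e`.
  obtain ⟨T, hT, hTe, hTε⟩ : ∃ T : ℝ, 0 ≤ T ∧ T • a ≤ e ∧ ¬ (T + ε) • a ≤ e := by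
    classical
    have hex := exists_nsmul_smul_not_le hX (e := e) ha.1 hε
    have hpos : Nat.find hex ≠ 0 := fun h0 => by
      have := Nat.find_spec hex
      rw [h0, Nat.cast_zero, zero_mul, zero_smul] at this
      exact this he
    obtain ⟨n, hn⟩ := Nat.exists_eq_succ_of_ne_zero hpos
    refine ⟨n * ε, by positivity, not_not.1 (Nat.find_min hex (by omega)), ?_⟩
    have := Nat.find_spec hex
    rwa [hn, Nat.cast_succ, add_mul, one_mul] at this
  refine hTε ?_
  have hzw' : z ≤ (e - T • a) + ε • a := by
    refine hzw _ (key _ ?_)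
    filter_upwards [h a haS ε hε] with y hy
    have h1 := add_inf_le_inf_add_inf (sub_nonneg.2 hTe) (smul_nonneg hT ha.1.le)
      (abs_nonneg (y - x))
    rw [sub_add_cancel, inf_comm e, inf_comm (T • a)] at h1
    exact h1.trans (add_le_add inf_le_left (ha.inf_smul_le (abs_nonneg _) hε1 hT hy))
  have h2 : (ε + ε) • a ≤ (e - T • a) + ε • a :=
    (smul_le_smul_of_nonneg_right hεc ha.1.le).trans (hcz.trans hzw')
  rw [add_smul, add_le_add_iff_right, le_sub_iff_add_le, add_comm, ← add_smul] at h2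
  exact h2

/-! ### Discreteness and the equivalences -/

theorem IsDiscreteLattice.isTopological_uoConvergence (hX : IsArchimedeanLattice X)
    (h : IsDiscreteLattice X) : (uoConvergence X).IsTopological := by
  obtain ⟨S, hS, -, hcompl⟩ := h
  refine ⟨⨅ a : S, (hS a a.2).pseudoMetricSpace.toUniformSpace.toTopologicalSpace, fun F x => ?_⟩
  rw [nhds_iInf, le_iInf_iff]
  simp only [IsLatticeAtom.le_nhds_iff]
  exact ⟨fun h a ε hε => (hS a a.2).eventually_of_uoConverges h hε,
    fun h => uoConverges_of_forall_atom hX hS hcompl fun a ha => h ⟨a, ha⟩⟩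

theorem exists_pos_forall_le_not_isLatticeAtom (h : ¬ IsDiscreteLattice X) :
    ∃ e : X, 0 < e ∧ ∀ z, z ≤ e → ¬ IsLatticeAtom z := by
  obtain ⟨S, hS⟩ := zorn_subset
    {S : Set X | (∀ a ∈ S, IsLatticeAtom a) ∧ S.Pairwise fun a b => a ⊓ b = 0} (by
      refine fun C hC hchain => ⟨⋃₀ C, ⟨?_, ?_⟩, fun s hs => Set.subset_sUnion_of_mem hs⟩
      · rintro a ⟨s, hs, has⟩
        exact (hC hs).1 a has
      · exact (Set.pairwise_sUnion hchain.directedOn).2 fun s hs => (hC hs).2)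
  have hnc : ¬ ∀ x : X, (∀ a ∈ S, |x| ⊓ a = 0) → x = 0 := fun hc =>
    h ⟨S, hS.prop.1, fun a ha b hb hab => hS.prop.2 ha hb hab, hc⟩
  push Not at hnc
  obtain ⟨x, hx, hx0⟩ := hnc
  refine ⟨|x|, (abs_nonneg x).lt_of_ne fun h0 => hx0 ?_, fun z hz hza => ?_⟩
  · exact le_antisymm ((le_abs_self x).trans h0.ge) (neg_nonpos.1 ((neg_le_abs x).trans h0.ge))
  have hzS : ∀ a ∈ S, z ⊓ a = 0 := fun a ha =>
    inf_eq_zero_of_le hza.1.le (hS.prop.1 a ha).1.le hz le_rfl (hx a ha)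
  -- Maximality forces the atom `z` into `S`, so `z` is disjoint from itself.
  have hmem : z ∈ S := by
    refine hS.le_of_ge (y := insert z S) ⟨?_, ?_⟩ (Set.subset_insert z S) (Set.mem_insert z S)
    · rintro a (rfl | ha)
      exacts [hza, hS.prop.1 a ha]
    · refine hS.prop.2.insert fun a ha _ => ⟨hzS a ha, ?_⟩
      rw [inf_comm]
      exact hzS a ha
  have := hzS z hmem
  rw [inf_idem] at this
  exact hza.1.ne' this

theorem isDiscreteLattice_of_isChoquet_uoConvergence (hX : IsArchimedeanLattice X)
    (h : (uoConvergence X).IsChoquet) : IsDiscreteLattice X := by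
  by_contra hd
  obtain ⟨e, he, hna⟩ := exists_pos_forall_le_not_isLatticeAtom hd
  exact not_uoConverges_smallSupportFilter hX he (h _ _ fun U hU =>
    uoConverges_of_le_smallSupportFilter hX (fun z hz hze =>
      exists_disjoint_le_of_not_isLatticeAtom hX hz (hna z hze)) hU)

end VectorLattice

theorem mainTheorem2 (X : Type u) [AddCommGroup X] [Lattice X] [IsOrderedAddMonoid X]
    [Module ℝ X] [IsOrderedModule ℝ X] (hX : IsArchimedeanLattice X) :
    List.TFAE [
      IsDiscreteLattice X,
      (orderConvergence X).IsChoquet,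
      (uoConvergence X).IsChoquet,
      (uoConvergence X).IsTopological] := by
  tfae_have 1 → 4 := fun h => h.isTopological_uoConvergence hX
  tfae_have 4 → 3 := fun h => h.isChoquet
  tfae_have 3 → 1 := isDiscreteLattice_of_isChoquet_uoConvergence hX
  tfae_have 3 → 2 := orderConvergence_isChoquet_of_uoConvergence
  tfae_have 2 → 3 := fun h => h.unbounded
  tfae_finish
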